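/- Let $\mathbb{K}$ be a field with a fixed embedding $\mathbb{K}\hookrightarrow\mathbb{C}$ (for example a subfield of $\overline{\mathbb{Q}}\subset\mathbb{C}$). Let $(\mathbb{K},\mathbb{Q})\mathrm{Vect}$ be the category of triples $V=(V_{\mathbb{K}},V_{\mathbb{Q}},\phi)$ consisting of a finite dimensional $\mathbb{K}$-vector space $V_{\mathbb{K}}$, a finite dimensional $\mathbb{Q}$-vector space $V_{\mathbb{Q}}$ and a $\mathbb{C}$-linear isomorphism $\phi\colon V_{\mathbb{K}}\otimes_{\mathbb{K}}\mathbb{C}\to V_{\mathbb{Q}}\otimes_{\mathbb{Q}}\mathbb{C}$; morphisms are pairs consisting of a $\mathbb{K}$-linear and a $\mathbb{Q}$-linear map that are compatible with the isomorphisms $\phi$. Let $\mathcal{C}$ be an abelian category and $T\colon\mathcal{C}\to(\mathbb{K},\mathbb{Q})\mathrm{Vect}$, $M\mapsto(T(M)_{\mathbb{K}},T(M)_{\mathbb{Q}},\phi_M)$, a faithful exact (additive) functor. The space of formal periods $\mathcal{P}(\mathcal{C})$ is the $\mathbb{Q}$-vector space generated by the symbols $(M,\sigma,\omega)$ with $M\in\mathcal{C}$,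 $\sigma\in T(M)_{\mathbb{Q}}^\vee$, $\omega\in T(M)_{\mathbb{K}}$, modulo the relations of $\mathbb{Q}$-bilinearity in $\sigma$ and $\omega$ and of functoriality, $(M,\sigma\circ T(f)_{\mathbb{Q}},\omega)=(N,\sigma,T(f)_{\mathbb{K}}(\omega))$ for every morphism $f\colon M\to N$ of $\mathcal{C}$, every $\sigma\in T(N)_{\mathbb{Q}}^\vee$ and every $\omega\in T(M)_{\mathbb{K}}$. The period conjecture is said to hold for $\mathcal{C}$ if the $\mathbb{Q}$-linear evaluation map $$\mathcal{P}(\mathcal{C})\to\mathbb{C},\qquad (M,\sigma,\omega)\mapsto\sigma_{\mathbb{C}}(\phi_M(\omega\otimes 1)),$$ is injective. If the period conjecture holds for $\mathcal{C}$, then $T$ is fully faithful and its essential image is closed under subquotients: every subquotient in $(\mathbb{K},\mathbb{Q})\mathrm{Vect}$ of an object $T(M)$ with $M\in\mathcal{C}$ is isomorphic to $T(N)$ for some $N\in\mathcal{C}$. -/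

import Mathlib

open CategoryTheory CategoryTheory.Limits
open scoped TensorProduct

universe w v u k

/-- An object of the category `(K, ℚ)-Vect`: a finite dimensional `K`-vector space `dR`, a finite
dimensional `ℚ`-vector space `sing`, and a `ℂ`-linear isomorphism between their complexifications.
Here `K` is a field embedded into `ℂ`. -/
structure KQVect (K : Type k) [Field K] [Algebra K ℂ] where
  dR : Type w
  sing : Type w
  [addCommGroupDR : AddCommGroup dR]
  [moduleDR : Module K dR]
  [finiteDR : Module.Finite K dR]
  [addCommGroupSing : AddCommGroup sing]
  [moduleSing : Module ℚ sing]
  [finiteSing : Module.Finite ℚ sing]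
  comparison : (ℂ ⊗[K] dR) ≃ₗ[ℂ] (ℂ ⊗[ℚ] sing)

namespace KQVect

variable {K : Type k} [Field K] [Algebra K ℂ]

attribute [instance] addCommGroupDR moduleDR finiteDR addCommGroupSing moduleSing finiteSing

/-- A morphism in `(K, ℚ)-Vect`: a pair of linear maps whose complexifications commute with the
comparison isomorphisms. -/
@[ext]
structure Hom (V W : KQVect.{w} K) where
  dR : V.dR →ₗ[K] W.dR
  sing : V.sing →ₗ[ℚ] W.sing
  comm : W.comparison.toLinearMap ∘ₗ dR.baseChange ℂ =
    sing.baseChange ℂ ∘ₗ V.comparison.toLinearMap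

instance : Category (KQVect.{w} K) where
  Hom V W := Hom V W
  id V :=
    { dR := LinearMap.id
      sing := LinearMap.id
      comm := by simp }
  comp f g :=
    { dR := g.dR ∘ₗ f.dR
      sing := g.sing ∘ₗ f.sing
      comm := by
        rw [LinearMap.baseChange_comp, LinearMap.baseChange_comp, ← LinearMap.comp_assoc, g.comm,
          LinearMap.comp_assoc, f.comm, LinearMap.comp_assoc] }

@[ext]
theorem hom_ext {V W : KQVect.{w} K} {f g : V ⟶ W} (h₁ : f.dR = g.dR) (h₂ : f.sing = g.sing) :
    f = g := Hom.ext h₁ h₂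

@[simp] theorem id_dR (V : KQVect.{w} K) : Hom.dR (𝟙 V) = LinearMap.id := rfl
@[simp] theorem id_sing (V : KQVect.{w} K) : Hom.sing (𝟙 V) = LinearMap.id := rfl
@[simp] theorem comp_dR {U V W : KQVect.{w} K} (f : U ⟶ V) (g : V ⟶ W) :
    (f ≫ g).dR = g.dR ∘ₗ f.dR := rfl
@[simp] theorem comp_sing {U V W : KQVect.{w} K} (f : U ⟶ V) (g : V ⟶ W) :
    (f ≫ g).sing = g.sing ∘ₗ f.sing := rfl

section Preadditive

variable {V W : KQVect.{w} K}

instance : Zero (V ⟶ W) := ⟨{ dR := 0, sing := 0, comm := by simp }⟩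

instance : Add (V ⟶ W) := ⟨fun f g =>
  { dR := f.dR + g.dR
    sing := f.sing + g.sing
    comm := by
      rw [LinearMap.baseChange_add, LinearMap.baseChange_add, LinearMap.comp_add,
        LinearMap.add_comp, f.comm, g.comm] }⟩

instance : Neg (V ⟶ W) := ⟨fun f =>
  { dR := -f.dR
    sing := -f.sing
    comm := by
      rw [LinearMap.baseChange_neg, LinearMap.baseChange_neg, LinearMap.comp_neg,
        LinearMap.neg_comp, f.comm] }⟩

@[simp] theorem zero_dR : (0 : V ⟶ W).dR = 0 := rfl
@[simp] theorem zero_sing : (0 : V ⟶ W).sing = 0 := rfl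
@[simp] theorem add_dR (f g : V ⟶ W) : (f + g).dR = f.dR + g.dR := rfl
@[simp] theorem add_sing (f g : V ⟶ W) : (f + g).sing = f.sing + g.sing := rfl
@[simp] theorem neg_dR (f : V ⟶ W) : (-f).dR = -f.dR := rfl
@[simp] theorem neg_sing (f : V ⟶ W) : (-f).sing = -f.sing := rfl

instance : AddCommGroup (V ⟶ W) where
  add_assoc f g h := by ext1 <;> simp [add_assoc]
  zero_add f := by ext1 <;> simp
  add_zero f := by ext1 <;> simp
  add_comm f g := by ext1 <;> simp [add_comm]
  neg_add_cancel f := by ext1 <;> simp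
  nsmul := nsmulRec
  zsmul := zsmulRec

end Preadditive

instance : Preadditive (KQVect.{w} K) where
  add_comp _ _ _ f f' g := by ext1 <;> simp [LinearMap.comp_add]
  comp_add _ _ _ f g g' := by ext1 <;> simp [LinearMap.add_comp]

/-- The period `σ_ℂ (φ (ω))` of `ω ∈ V_K` and `σ ∈ V_ℚ^∨`. -/
noncomputable def period (V : KQVect.{w} K) (σ : Module.Dual ℚ V.sing) (ω : V.dR) : ℂ :=
  TensorProduct.AlgebraTensorModule.rid ℚ ℂ ℂ
    (LinearMap.baseChange ℂ σ (V.comparison (1 ⊗ₜ[K] ω)))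

theorem period_add_left (V : KQVect.{w} K) (σ τ : Module.Dual ℚ V.sing) (ω : V.dR) :
    V.period (σ + τ) ω = V.period σ ω + V.period τ ω := by
  simp [period, LinearMap.baseChange_add]

theorem period_smul_left (V : KQVect.{w} K) (a : ℚ) (σ : Module.Dual ℚ V.sing) (ω : V.dR) :
    V.period (a • σ) ω = a • V.period σ ω := by
  simp only [period, LinearMap.baseChange_smul, LinearMap.smul_apply]
  exact map_rat_smul (TensorProduct.AlgebraTensorModule.rid ℚ ℂ ℂ) a _

theorem period_add_right (V : KQVect.{w} K) (σ : Module.Dual ℚ V.sing) (ω η : V.dR) :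
    V.period σ (ω + η) = V.period σ ω + V.period σ η := by
  simp [period, TensorProduct.tmul_add]

theorem period_smul_right (V : KQVect.{w} K) (a : K) (σ : Module.Dual ℚ V.sing) (ω : V.dR) :
    V.period σ (a • ω) = algebraMap K ℂ a * V.period σ ω := by
  have h : (1 : ℂ) ⊗ₜ[K] (a • ω) = (algebraMap K ℂ a) • ((1 : ℂ) ⊗ₜ[K] ω) := by
    rw [TensorProduct.tmul_smul, algebraMap_smul]
  simp only [period, h, map_smul, smul_eq_mul]

theorem period_map {V W : KQVect.{w} K} (f : V ⟶ W) (σ : Module.Dual ℚ W.sing) (ω : V.dR) :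
    V.period (σ ∘ₗ f.sing) ω = W.period σ (f.dR ω) := by
  have h := LinearMap.congr_fun f.comm ((1 : ℂ) ⊗ₜ[K] ω)
  simp only [LinearMap.comp_apply, LinearMap.baseChange_tmul, LinearEquiv.coe_coe] at h
  simp only [period, LinearMap.baseChange_comp, LinearMap.comp_apply, h]

end KQVect

section FormalPeriods

variable {K : Type k} [Field K] [Algebra K ℂ] {C : Type u} [Category.{v} C]

/-- The symbols `(M, σ, ω)` with `M` in `C`, `σ ∈ T(M)_ℚ^∨` and `ω ∈ T(M)_K`. -/
structure PeriodSymbol (T : C ⥤ KQVect.{w} K) where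
  obj : C
  chain : Module.Dual ℚ (T.obj obj).sing
  form : (T.obj obj).dR

/-- The free `ℚ`-vector space on the symbols `(M, σ, ω)`. -/
abbrev FreePeriodSpace (T : C ⥤ KQVect.{w} K) : Type max u w := PeriodSymbol T →₀ ℚ

/-- The symbol `(M, σ, ω)` as a basis element of the free vector space. -/
noncomputable def freeSymbol (T : C ⥤ KQVect.{w} K) (M : C) (σ : Module.Dual ℚ (T.obj M).sing)
    (ω : (T.obj M).dR) : FreePeriodSpace T :=
  Finsupp.single ⟨M, σ, ω⟩ 1

/-- The defining relations of the space of formal periods, `PeriodRel T x y` meaning `x ∼ y`: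
`ℚ`-bilinearity in `σ` and `ω`, and functoriality in `M`. -/
inductive PeriodRel (T : C ⥤ KQVect.{w} K) : FreePeriodSpace T → FreePeriodSpace T → Prop
  | add_chain (M : C) (σ τ : Module.Dual ℚ (T.obj M).sing) (ω : (T.obj M).dR) :
      PeriodRel T (freeSymbol T M (σ + τ) ω) (freeSymbol T M σ ω + freeSymbol T M τ ω)
  | smul_chain (M : C) (a : ℚ) (σ : Module.Dual ℚ (T.obj M).sing) (ω : (T.obj M).dR) :
      PeriodRel T (freeSymbol T M (a • σ) ω) (a • freeSymbol T M σ ω)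
  | add_form (M : C) (σ : Module.Dual ℚ (T.obj M).sing) (ω η : (T.obj M).dR) :
      PeriodRel T (freeSymbol T M σ (ω + η)) (freeSymbol T M σ ω + freeSymbol T M σ η)
  | smul_form (M : C) (a : ℚ) (σ : Module.Dual ℚ (T.obj M).sing) (ω : (T.obj M).dR) :
      PeriodRel T (freeSymbol T M σ ((a : K) • ω)) (a • freeSymbol T M σ ω)
  | functoriality {M N : C} (f : M ⟶ N) (σ : Module.Dual ℚ (T.obj N).sing) (ω : (T.obj M).dR) :
      PeriodRel T (freeSymbol T M (σ ∘ₗ (T.map f).sing) ω) (freeSymbol T N σ ((T.map f).dR ω))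

/-- The subspace of the free vector space spanned by the relations. -/
noncomputable def periodRelations (T : C ⥤ KQVect.{w} K) : Submodule ℚ (FreePeriodSpace T) :=
  Submodule.span ℚ {z | ∃ x y, PeriodRel T x y ∧ z = x - y}

/-- The space of formal periods of `C` (with respect to `T`). -/
abbrev FormalPeriods (T : C ⥤ KQVect.{w} K) : Type max u w :=
  FreePeriodSpace T ⧸ periodRelations T

/-- The evaluation of symbols, extended linearly to the free vector space. -/
noncomputable def freeEval (T : C ⥤ KQVect.{w} K) : FreePeriodSpace T →ₗ[ℚ] ℂ :=
  Finsupp.linearCombination ℚ fun s : PeriodSymbol T => (T.obj s.obj).period s.chain s.form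

@[simp]
theorem freeEval_freeSymbol (T : C ⥤ KQVect.{w} K) (M : C) (σ : Module.Dual ℚ (T.obj M).sing)
    (ω : (T.obj M).dR) : freeEval T (freeSymbol T M σ ω) = (T.obj M).period σ ω := by
  simp [freeEval, freeSymbol]

theorem freeEval_eq_of_rel (T : C ⥤ KQVect.{w} K) {x y : FreePeriodSpace T}
    (h : PeriodRel T x y) : freeEval T x = freeEval T y := by
  cases h with
  | add_chain M σ τ ω => simp [KQVect.period_add_left]
  | smul_chain M a σ ω =>
    rw [map_smul, freeEval_freeSymbol, freeEval_freeSymbol, KQVect.period_smul_left]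
  | add_form M σ ω η => simp [KQVect.period_add_right]
  | smul_form M a σ ω =>
    rw [map_smul, freeEval_freeSymbol, freeEval_freeSymbol, KQVect.period_smul_right, map_ratCast,
      Rat.smul_def]
  | functoriality f σ ω => simp [KQVect.period_map]

theorem periodRelations_le_ker (T : C ⥤ KQVect.{w} K) :
    periodRelations T ≤ LinearMap.ker (freeEval T) := by
  refine Submodule.span_le.2 ?_
  rintro _ ⟨x, y, h, rfl⟩
  simp [freeEval_eq_of_rel T h]

/-- The evaluation map from formal periods to complex numbers, `(M, σ, ω) ↦ σ_ℂ (φ_M (ω))`. -/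
noncomputable def evalPeriods (T : C ⥤ KQVect.{w} K) : FormalPeriods T →ₗ[ℚ] ℂ :=
  (periodRelations T).liftQ (freeEval T) (periodRelations_le_ker T)

/-- The period conjecture for `C` (with respect to `T`): the surjection from the space of formal
periods onto its image in `ℂ`, the space of periods, is injective. -/
def PeriodConjecture (T : C ⥤ KQVect.{w} K) : Prop :=
  Function.Injective (evalPeriods T)

end FormalPeriods

/-- `V` is a subquotient of `W`: a quotient of a subobject of `W`. -/
def IsSubquotient {D : Type u} [Category.{v} D] (V W : D) : Prop :=
  ∃ (U : D) (i : U ⟶ W) (p : U ⟶ V), Mono i ∧ Epi p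

/-! Let `i : V ⟶ T.obj M` be mono. For ω in V_K and σ in the annihilator of V_ℚ the number σ_ℂ(φ(ω))
is zero, so the period conjecture makes the formal symbol (M, σ, ω) zero. That vanishing uses
finitely many relations, and each is witnessed by a finite diagram of pairs (object, form). Such
pairs form a cofiltered category, so one cone over all these diagrams gives a morphism N → M through
which ω lifts and along which σ pulls back to zero (`exists_hom_of_freeSymbol_mem`).

Letting ω and σ run over finite generating sets gives g : L → M such that the range of T(g)_K
contains V_K and the range of T(g)_ℚ lies in V_ℚ. The two components of an object have equal
dimension, so both inclusions are equalities and V is T of the image of g (`exists_iso_of_mono`).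
Fullness follows by applying this to graphs, and closure under quotients by applying it to kernels.
-/

namespace KQVect

variable {K : Type k} [Field K] [Algebra K ℂ]

/-! ### Componentwise kernels and cokernels in (K, ℚ)-Vect. -/

theorem baseChange_injective {F : Type*} [Field F] [Algebra F ℂ] {X Y : Type*} [AddCommGroup X]
    [Module F X] [AddCommGroup Y] [Module F Y] (f : X →ₗ[F] Y) (hf : Function.Injective f) :
    Function.Injective (f.baseChange ℂ) :=
  Module.Flat.lTensor_preserves_injective_linearMap f hf

/-- This lets opposite inclusions on the two components force equality on both. -/
theorem finrank_dR_eq_finrank_sing (V : KQVect.{w} K) :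
    Module.finrank K V.dR = Module.finrank ℚ V.sing := by
  have h := V.comparison.finrank_eq
  rwa [Module.finrank_baseChange, Module.finrank_baseChange] at h

theorem comm_apply {V W : KQVect.{w} K} (f : V ⟶ W) (x : ℂ ⊗[K] V.dR) :
    W.comparison (f.dR.baseChange ℂ x) = f.sing.baseChange ℂ (V.comparison x) :=
  LinearMap.congr_fun f.comm x

/-- The complexification of a kernel is the kernel of the complexification. -/
noncomputable def kerBaseChangeEquiv {F : Type*} [Field F] [Algebra F ℂ] {X Y : Type*}
    [AddCommGroup X] [Module F X] [AddCommGroup Y] [Module F Y] (f : X →ₗ[F] Y) :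
    (ℂ ⊗[F] LinearMap.ker f) ≃ₗ[ℂ] LinearMap.ker (f.baseChange ℂ) :=
  LinearEquiv.ofInjective ((LinearMap.ker f).subtype.baseChange ℂ)
      (baseChange_injective _ (Submodule.subtype_injective _)) ≪≫ₗ
    LinearEquiv.ofEq _ _ (by
      ext x
      exact (Module.Flat.lTensor_exact ℂ f.exact_subtype_ker_map x).symm)

@[simp]
theorem coe_kerBaseChangeEquiv {F : Type*} [Field F] [Algebra F ℂ] {X Y : Type*}
    [AddCommGroup X] [Module F X] [AddCommGroup Y] [Module F Y] (f : X →ₗ[F] Y)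
    (x : ℂ ⊗[F] LinearMap.ker f) :
    (kerBaseChangeEquiv f x : ℂ ⊗[F] X) = (LinearMap.ker f).subtype.baseChange ℂ x := rfl

/-- The complexification of the quotient by a range is the quotient by the range of the
complexification. -/
noncomputable def cokerBaseChangeEquiv {F : Type*} [Field F] [Algebra F ℂ] {X Y : Type*}
    [AddCommGroup X] [Module F X] [AddCommGroup Y] [Module F Y] (f : X →ₗ[F] Y) :
    ((ℂ ⊗[F] Y) ⧸ LinearMap.range (f.baseChange ℂ)) ≃ₗ[ℂ] ℂ ⊗[F] (Y ⧸ LinearMap.range f) :=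
  Submodule.quotEquivOfEq _ _ (by
      ext x
      exact (lTensor_exact ℂ (f.exact_map_mkQ_range) (Submodule.mkQ_surjective _) x).symm) ≪≫ₗ
    LinearMap.quotKerEquivOfSurjective ((LinearMap.range f).mkQ.baseChange ℂ)
      (LinearMap.lTensor_surjective ℂ (Submodule.mkQ_surjective _))

@[simp]
theorem cokerBaseChangeEquiv_mk {F : Type*} [Field F] [Algebra F ℂ] {X Y : Type*}
    [AddCommGroup X] [Module F X] [AddCommGroup Y] [Module F Y] (f : X →ₗ[F] Y) (y : ℂ ⊗[F] Y) :
    cokerBaseChangeEquiv f (Submodule.Quotient.mk y) = (LinearMap.range f).mkQ.baseChange ℂ y :=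
  rfl

section Kernel

variable {V W : KQVect.{w} K} (f : V ⟶ W)

/-- The comparison isomorphism between the kernels of the two components of a morphism. -/
noncomputable def kerComparison :
    (ℂ ⊗[K] LinearMap.ker f.dR) ≃ₗ[ℂ] ℂ ⊗[ℚ] LinearMap.ker f.sing :=
  kerBaseChangeEquiv f.dR ≪≫ₗ
    V.comparison.ofSubmodules _ (LinearMap.ker (f.sing.baseChange ℂ)) (by
      ext x
      rw [Submodule.mem_map_equiv, LinearMap.mem_ker, LinearMap.mem_ker,
        ← W.comparison.map_eq_zero_iff, comm_apply, LinearEquiv.apply_symm_apply]) ≪≫ₗ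
    (kerBaseChangeEquiv f.sing).symm

theorem subtype_kerComparison (x : ℂ ⊗[K] LinearMap.ker f.dR) :
    (LinearMap.ker f.sing).subtype.baseChange ℂ (kerComparison f x) =
      V.comparison ((LinearMap.ker f.dR).subtype.baseChange ℂ x) := by
  rw [← coe_kerBaseChangeEquiv, kerComparison, LinearEquiv.trans_apply, LinearEquiv.trans_apply,
    LinearEquiv.apply_symm_apply]
  rfl

/-- The kernel of a morphism, taken componentwise. -/
noncomputable def ker : KQVect.{w} K where
  dR := LinearMap.ker f.dR
  sing := LinearMap.ker f.sing
  comparison := kerComparison f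

/-- The inclusion of the kernel of a morphism. -/
noncomputable def kerι : ker f ⟶ V where
  dR := (LinearMap.ker f.dR).subtype
  sing := (LinearMap.ker f.sing).subtype
  comm := LinearMap.ext fun x => (subtype_kerComparison f x).symm

theorem kerι_comp : kerι f ≫ f = 0 := by
  ext1
  · exact LinearMap.comp_ker_subtype f.dR
  · exact LinearMap.comp_ker_subtype f.sing

theorem mono_kerι : Mono (kerι f) where
  right_cancellation g h hgh := by
    ext1
    · exact (LinearMap.cancel_left (Submodule.subtype_injective _)).1 (congrArg Hom.dR hgh)
    · exact (LinearMap.cancel_left (Submodule.subtype_injective _)).1 (congrArg Hom.sing hgh)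

/-- The comparison isomorphism between the cokernels of the two components of a morphism. -/
noncomputable def cokerComparison :
    (ℂ ⊗[K] (W.dR ⧸ LinearMap.range f.dR)) ≃ₗ[ℂ] ℂ ⊗[ℚ] (W.sing ⧸ LinearMap.range f.sing) :=
  (cokerBaseChangeEquiv f.dR).symm ≪≫ₗ
    Submodule.Quotient.equiv _ (LinearMap.range (f.sing.baseChange ℂ)) W.comparison (by
      have h : LinearMap.range V.comparison.toLinearMap = ⊤ := LinearEquiv.range _
      refine (LinearMap.range_comp _ W.comparison.toLinearMap).symm.trans ?_
      rw [f.comm, LinearMap.range_comp, h, LinearMap.range_eq_map]) ≪≫ₗ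
    cokerBaseChangeEquiv f.sing

theorem cokerComparison_mkQ (x : ℂ ⊗[K] W.dR) :
    cokerComparison f ((LinearMap.range f.dR).mkQ.baseChange ℂ x) =
      (LinearMap.range f.sing).mkQ.baseChange ℂ (W.comparison x) := by
  rw [← cokerBaseChangeEquiv_mk, cokerComparison, LinearEquiv.trans_apply, LinearEquiv.trans_apply,
    LinearEquiv.symm_apply_apply]
  rfl

/-- The cokernel of a morphism, taken componentwise. -/
noncomputable def coker : KQVect.{w} K where
  dR := W.dR ⧸ LinearMap.range f.dR
  sing := W.sing ⧸ LinearMap.range f.sing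
  comparison := cokerComparison f

/-- The projection onto the cokernel of a morphism. -/
noncomputable def cokerπ : W ⟶ coker f where
  dR := (LinearMap.range f.dR).mkQ
  sing := (LinearMap.range f.sing).mkQ
  comm := LinearMap.ext fun x => cokerComparison_mkQ f x

theorem comp_cokerπ : f ≫ cokerπ f = 0 := by
  ext1
  · exact LinearMap.range_mkQ_comp f.dR
  · exact LinearMap.range_mkQ_comp f.sing

/-- The componentwise kernel is itself an object, so its inclusion is a morphism killed by `f`,
hence zero. -/
theorem injective_of_mono [Mono f] : Function.Injective f.dR ∧ Function.Injective f.sing := by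
  have h : kerι f = 0 := by
    rw [← cancel_mono f, kerι_comp, zero_comp]
  constructor
  · rw [← LinearMap.ker_eq_bot, eq_bot_iff]
    exact fun x hx => LinearMap.congr_fun (congrArg Hom.dR h) ⟨x, hx⟩
  · rw [← LinearMap.ker_eq_bot, eq_bot_iff]
    exact fun x hx => LinearMap.congr_fun (congrArg Hom.sing h) ⟨x, hx⟩

theorem surjective_of_epi [Epi f] : Function.Surjective f.dR ∧ Function.Surjective f.sing := by
  have h : cokerπ f = 0 := by
    rw [← cancel_epi f, comp_cokerπ, comp_zero]
  constructor
  · rw [← LinearMap.range_eq_top, ← Submodule.ker_mkQ (LinearMap.range f.dR)]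
    exact LinearMap.ker_eq_top.2 (congrArg Hom.dR h)
  · rw [← LinearMap.range_eq_top, ← Submodule.ker_mkQ (LinearMap.range f.sing)]
    exact LinearMap.ker_eq_top.2 (congrArg Hom.sing h)

end Kernel

/-- A morphism that is bijective on both components is an isomorphism. -/
theorem isIso_of_bijective {V W : KQVect.{w} K} (f : V ⟶ W) (h₁ : Function.Bijective f.dR)
    (h₂ : Function.Bijective f.sing) : IsIso f := by
  let e₁ := LinearEquiv.ofBijective f.dR h₁
  let e₂ := LinearEquiv.ofBijective f.sing h₂
  have a₁ : f.dR ∘ₗ e₁.symm.toLinearMap = LinearMap.id := LinearMap.ext e₁.apply_symm_apply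
  have a₂ : f.sing ∘ₗ e₂.symm.toLinearMap = LinearMap.id := LinearMap.ext e₂.apply_symm_apply
  have b₁ : e₁.symm.toLinearMap ∘ₗ f.dR = LinearMap.id := LinearMap.ext e₁.symm_apply_apply
  have b₂ : e₂.symm.toLinearMap ∘ₗ f.sing = LinearMap.id := LinearMap.ext e₂.symm_apply_apply
  let g : W ⟶ V :=
    { dR := e₁.symm.toLinearMap
      sing := e₂.symm.toLinearMap
      comm := by
        -- Compatibility is tested after the injective complexification of `f.sing`, where it
        -- reduces to that of `f`.
        refine LinearMap.ext fun x => baseChange_injective f.sing h₂.1 ?_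
        simp only [LinearMap.comp_apply, LinearEquiv.coe_coe]
        rw [← comm_apply, ← LinearMap.comp_apply, ← LinearMap.baseChange_comp, a₁,
          ← LinearMap.comp_apply, ← LinearMap.baseChange_comp, a₂]
        simp }
  exact ⟨g, by ext1; exacts [b₁, b₂], by ext1; exacts [a₁, a₂]⟩

/-- A morphism factors through a componentwise injective one if it does so on both ranges. -/
theorem exists_lift {A B W : KQVect.{w} K} (i : A ⟶ W) (j : B ⟶ W)
    (h₁ : Function.Injective j.dR) (h₂ : Function.Injective j.sing)
    (r₁ : LinearMap.range i.dR ≤ LinearMap.range j.dR)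
    (r₂ : LinearMap.range i.sing ≤ LinearMap.range j.sing) : ∃ h : A ⟶ B, h ≫ j = i := by
  let l₁ : A.dR →ₗ[K] B.dR := (LinearEquiv.ofInjective j.dR h₁).symm.toLinearMap ∘ₗ
    i.dR.codRestrict _ fun x => r₁ ⟨x, rfl⟩
  let l₂ : A.sing →ₗ[ℚ] B.sing := (LinearEquiv.ofInjective j.sing h₂).symm.toLinearMap ∘ₗ
    i.sing.codRestrict _ fun x => r₂ ⟨x, rfl⟩
  have e₁ : j.dR ∘ₗ l₁ = i.dR := LinearMap.ext fun x =>
    congrArg Subtype.val ((LinearEquiv.ofInjective j.dR h₁).apply_symm_apply _)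
  have e₂ : j.sing ∘ₗ l₂ = i.sing := LinearMap.ext fun x =>
    congrArg Subtype.val ((LinearEquiv.ofInjective j.sing h₂).apply_symm_apply _)
  refine ⟨{ dR := l₁, sing := l₂, comm := ?_ }, by ext1; exacts [e₁, e₂]⟩
  refine LinearMap.ext fun x => baseChange_injective j.sing h₂ ?_
  simp only [LinearMap.comp_apply, LinearEquiv.coe_coe]
  rw [← comm_apply, ← LinearMap.comp_apply, ← LinearMap.baseChange_comp, e₁,
    ← LinearMap.comp_apply, ← LinearMap.baseChange_comp, e₂, comm_apply]

/-- Componentwise injective morphisms with the same ranges have isomorphic sources. -/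
theorem exists_iso_of_range_eq {A B W : KQVect.{w} K} (i : A ⟶ W) (j : B ⟶ W) [Mono i] [Mono j]
    (r₁ : LinearMap.range i.dR = LinearMap.range j.dR)
    (r₂ : LinearMap.range i.sing = LinearMap.range j.sing) : ∃ e : A ≅ B, e.hom ≫ j = i := by
  obtain ⟨h, hh⟩ := exists_lift i j (injective_of_mono j).1 (injective_of_mono j).2 r₁.le r₂.le
  obtain ⟨g, hg⟩ := exists_lift j i (injective_of_mono i).1 (injective_of_mono i).2 r₁.ge r₂.ge
  exact ⟨⟨h, g, by rw [← cancel_mono i]; simp [hh, hg], by rw [← cancel_mono j]; simp [hh, hg]⟩, hh⟩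

end KQVect

/-! ### The cofiltered category of objects with a form. -/

section PeriodConjecture

variable {K : Type k} [Field K] [Algebra K ℂ] {C : Type u} [Category.{v} C]

/-- An object `M` of `C` with an element of `T(M)_K`. -/
@[ext]
structure PointedObj (T : C ⥤ KQVect.{w} K) where
  obj : C
  form : (T.obj obj).dR

namespace PointedObj

/-- Morphisms of `C` that map the one element to the other. -/
@[ext]
structure Hom {T : C ⥤ KQVect.{w} K} (X Y : PointedObj T) where
  hom : X.obj ⟶ Y.obj
  map_form : (T.map hom).dR X.form = Y.form

instance (T : C ⥤ KQVect.{w} K) : Category.{v} (PointedObj T) where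
  Hom := Hom
  id X := ⟨𝟙 X.obj, by simp⟩
  comp f g := ⟨f.hom ≫ g.hom, by simp [f.map_form, g.map_form]⟩

variable {T : C ⥤ KQVect.{w} K}

@[ext]
theorem hom_ext {X Y : PointedObj T} {f g : X ⟶ Y} (h : f.hom = g.hom) : f = g := Hom.ext h

@[simp] theorem comp_hom {X Y Z : PointedObj T} (f : X ⟶ Y) (g : Y ⟶ Z) :
    (f ≫ g).hom = f.hom ≫ g.hom := rfl

end PointedObj

theorem map_comp_dR_apply (T : C ⥤ KQVect.{w} K) {L M N : C} (f : L ⟶ M) (g : M ⟶ N)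
    (x : (T.obj L).dR) :
    (T.map g).dR ((T.map f).dR x) = (T.map (f ≫ g)).dR x := by
  rw [T.map_comp]; rfl

section Exact

variable [Abelian C] (T : C ⥤ KQVect.{w} K)

theorem exists_map_kernel_ι_eq [PreservesFiniteLimits T] [T.Additive] {M N : C} (f : M ⟶ N)
    (x : (T.obj M).dR) (hx : (T.map f).dR x = 0) :
    ∃ y : (T.obj (kernel f)).dR, (T.map (kernel.ι f)).dR y = x := by
  obtain ⟨l, hl⟩ := KernelFork.IsLimit.lift' (isLimitOfHasKernelOfPreservesLimit T f)
    (KQVect.kerι (T.map f)) (KQVect.kerι_comp _)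
  refine ⟨l.dR ⟨x, hx⟩, ?_⟩
  have h := congrArg KQVect.Hom.dR hl
  exact LinearMap.congr_fun h ⟨x, hx⟩

variable [T.Additive]

theorem map_zsmul_dR {M N : C} (f : M ⟶ N) (n : ℤ) : (T.map (n • f)).dR = n • (T.map f).dR := by
  let F : (M ⟶ N) →+ ((T.obj M).dR →ₗ[K] (T.obj N).dR) :=
    { toFun := fun g => (T.map g).dR
      map_zero' := by rw [T.map_zero]; rfl
      map_add' := fun g h => by rw [T.map_add]; rfl }
  exact map_zsmul F n f

theorem map_zsmul_sing {M N : C} (f : M ⟶ N) (n : ℤ) :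
    (T.map (n • f)).sing = n • (T.map f).sing := by
  let F : (M ⟶ N) →+ ((T.obj M).sing →ₗ[ℚ] (T.obj N).sing) :=
    { toFun := fun g => (T.map g).sing
      map_zero' := by rw [T.map_zero]; rfl
      map_add' := fun g h => by rw [T.map_add]; rfl }
  exact map_zsmul F n f

/-- The element of `T(M ⊞ N)_K` with given components. -/
noncomputable def pairForm {M N : C} (x : (T.obj M).dR) (y : (T.obj N).dR) :
    (T.obj (M ⊞ N)).dR :=
  (T.map biprod.inl).dR x + (T.map biprod.inr).dR y

theorem fst_pairForm {M N : C} (x : (T.obj M).dR) (y : (T.obj N).dR) :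
    (T.map biprod.fst).dR (pairForm T x y) = x := by
  simp [pairForm, map_comp_dR_apply]

theorem snd_pairForm {M N : C} (x : (T.obj M).dR) (y : (T.obj N).dR) :
    (T.map biprod.snd).dR (pairForm T x y) = y := by
  simp [pairForm, map_comp_dR_apply]

/-- Two pairs are dominated by their biproduct. Parallel arrows are equalized by the kernel of their
difference, to which the form lifts by left exactness of `T`. -/
instance [PreservesFiniteLimits T] : IsCofiltered (PointedObj T) where
  cone_objs X Y := ⟨⟨X.obj ⊞ Y.obj, pairForm T X.form Y.form⟩,
    ⟨biprod.fst, fst_pairForm T _ _⟩, ⟨biprod.snd, snd_pairForm T _ _⟩, trivial⟩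
  cone_maps X Y f g := by
    obtain ⟨y, hy⟩ := exists_map_kernel_ι_eq T (f.hom - g.hom) X.form (by
      rw [sub_eq_add_neg, T.map_add, T.map_neg, KQVect.add_dR, KQVect.neg_dR, LinearMap.add_apply,
        LinearMap.neg_apply, f.map_form, g.map_form, add_neg_cancel])
    refine ⟨⟨_, y⟩, ⟨kernel.ι _, hy⟩, PointedObj.hom_ext ?_⟩
    have h := kernel.condition (f.hom - g.hom)
    rwa [Preadditive.comp_sub, sub_eq_zero] at h
  nonempty := ⟨⟨(HasZeroObject.zero (C := C)).choose, 0⟩⟩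

end Exact

/-! ### Vanishing of formal periods is detected on finite diagrams. -/

section Compatible

variable (T : C ⥤ KQVect.{w} K) {W : Type w} [AddCommGroup W] [Module ℚ W]

/-- The linear extension to symbols of pulling back `σ` along a family of maps into the `T(M)_ℚ`
indexed by the pairs `(M, ω)`. -/
noncomputable def pullbackChain (f : ∀ X : PointedObj T, W →ₗ[ℚ] (T.obj X.obj).sing) :
    FreePeriodSpace T →ₗ[ℚ] Module.Dual ℚ W :=
  Finsupp.linearCombination ℚ fun s : PeriodSymbol T => s.chain ∘ₗ f ⟨s.obj, s.form⟩

@[simp]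
theorem pullbackChain_freeSymbol (f : ∀ X : PointedObj T, W →ₗ[ℚ] (T.obj X.obj).sing) (M : C)
    (σ : Module.Dual ℚ (T.obj M).sing) (ω : (T.obj M).dR) :
    pullbackChain T f (freeSymbol T M σ ω) = σ ∘ₗ f ⟨M, ω⟩ := by
  simp [pullbackChain, freeSymbol]

/-- A family of maps into the `T(M)_ℚ` is compatible with a morphism of pairs. -/
def CompatibleWith {T : C ⥤ KQVect.{w} K} (f : ∀ X : PointedObj T, W →ₗ[ℚ] (T.obj X.obj).sing)
    (h : Σ X Y : PointedObj T, X ⟶ Y) : Prop :=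
  (T.map h.2.2.hom).sing ∘ₗ f h.1 = f h.2.1

variable {T}

/-- Linearity in σ needs no arrows. Linearity in ω is realized by arrows out of a common pair, and
functoriality by a single arrow. `H` is chosen before `W` and `f`, so that one cone can later serve
several relations. -/
theorem exists_compatible_of_rel [Abelian C] [T.Additive] {x y : FreePeriodSpace T}
    (h : PeriodRel T x y) :
    ∃ H : Finset (Σ X Y : PointedObj T, X ⟶ Y),
      ∀ (W : Type w) [AddCommGroup W] [Module ℚ W]
        (f : ∀ X : PointedObj T, W →ₗ[ℚ] (T.obj X.obj).sing),
        (∀ h ∈ H, CompatibleWith f h) → pullbackChain T f x = pullbackChain T f y := by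
  classical
  cases h with
  | add_chain M σ τ ω => exact ⟨∅, fun W _ _ f _ => by simp [LinearMap.add_comp]⟩
  | smul_chain M a σ ω => exact ⟨∅, fun W _ _ f _ => by simp [LinearMap.smul_comp]⟩
  | add_form M σ ω η =>
    let P : PointedObj T := ⟨M ⊞ M, pairForm T ω η⟩
    let p : P ⟶ ⟨M, ω⟩ := ⟨biprod.fst, fst_pairForm T _ _⟩
    let q : P ⟶ ⟨M, η⟩ := ⟨biprod.snd, snd_pairForm T _ _⟩
    -- Additivity of `T` makes the sum of the projections send the paired form to `ω + η`.
    let s : P ⟶ ⟨M, ω + η⟩ := ⟨biprod.fst + biprod.snd, by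
      rw [T.map_add, KQVect.add_dR, LinearMap.add_apply, fst_pairForm, snd_pairForm]⟩
    refine ⟨{⟨_, _, p⟩, ⟨_, _, q⟩, ⟨_, _, s⟩}, fun W _ _ f hf => ?_⟩
    have hp : _ = _ := hf ⟨_, _, p⟩ (by simp)
    have hq : _ = _ := hf ⟨_, _, q⟩ (by simp)
    have hs : _ = _ := hf ⟨_, _, s⟩ (by simp)
    simp only [map_add, pullbackChain_freeSymbol]
    rw [← hp, ← hq, ← hs]
    simp only [p, q, s, T.map_add, KQVect.add_sing, LinearMap.add_comp, LinearMap.comp_add]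
  | smul_form M a σ ω =>
    have := (algebraMap K ℂ).charZero
    have hd : (a.den : K) ≠ 0 := Nat.cast_ne_zero.2 a.den_nz
    -- Only integers act on morphisms of `C`, so ω and a • ω are both obtained from ω / den, as its
    -- multiples by the denominator and the numerator.
    let P : PointedObj T := ⟨M, (a.den : K)⁻¹ • ω⟩
    let p : P ⟶ ⟨M, ω⟩ := ⟨(a.den : ℤ) • 𝟙 M, by
      rw [map_zsmul_dR, T.map_id, LinearMap.smul_apply, KQVect.id_dR, LinearMap.id_apply,
        ← Int.cast_smul_eq_zsmul K, Int.cast_natCast, smul_inv_smul₀ hd]⟩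
    let q : P ⟶ ⟨M, (a : K) • ω⟩ := ⟨a.num • 𝟙 M, by
      rw [map_zsmul_dR, T.map_id, LinearMap.smul_apply, KQVect.id_dR, LinearMap.id_apply,
        ← Int.cast_smul_eq_zsmul K, smul_smul, ← div_eq_mul_inv, ← Rat.cast_def]⟩
    refine ⟨{⟨_, _, p⟩, ⟨_, _, q⟩}, fun W _ _ f hf => ?_⟩
    have hp : _ = _ := hf ⟨_, _, p⟩ (by simp)
    have hq : _ = _ := hf ⟨_, _, q⟩ (by simp)
    simp only [map_smul, pullbackChain_freeSymbol]
    rw [← hp, ← hq]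
    simp only [p, q, map_zsmul_sing, LinearMap.smul_comp, LinearMap.comp_smul,
      ← Int.cast_smul_eq_zsmul ℚ, smul_smul, Int.cast_natCast,
      Rat.mul_den_eq_num]
  | @functoriality M N g σ ω =>
    let p : (⟨M, ω⟩ : PointedObj T) ⟶ ⟨N, (T.map g).dR ω⟩ := ⟨g, rfl⟩
    refine ⟨{⟨_, _, p⟩}, fun W _ _ f hf => ?_⟩
    have hp : _ = _ := hf ⟨_, _, p⟩ (by simp)
    simp only [pullbackChain_freeSymbol]
    rw [← hp, LinearMap.comp_assoc]

theorem exists_compatible_of_mem_periodRelations [Abelian C] [T.Additive] {x : FreePeriodSpace T}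
    (hx : x ∈ periodRelations T) :
    ∃ H : Finset (Σ X Y : PointedObj T, X ⟶ Y),
      ∀ (W : Type w) [AddCommGroup W] [Module ℚ W]
        (f : ∀ X : PointedObj T, W →ₗ[ℚ] (T.obj X.obj).sing),
        (∀ h ∈ H, CompatibleWith f h) → pullbackChain T f x = 0 := by
  classical
  induction hx using Submodule.span_induction with
  | mem x hx =>
    obtain ⟨y, z, h, rfl⟩ := hx
    obtain ⟨H, hH⟩ := exists_compatible_of_rel h
    exact ⟨H, fun W _ _ f hf => by rw [map_sub, hH W f hf, sub_self]⟩
  | zero => exact ⟨∅, fun W _ _ f _ => map_zero _⟩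
  | add x y _ _ hx hy =>
    obtain ⟨H₁, h₁⟩ := hx
    obtain ⟨H₂, h₂⟩ := hy
    refine ⟨H₁ ∪ H₂, fun W _ _ f hf => ?_⟩
    rw [map_add, h₁ W f fun h hh => hf h (Finset.mem_union_left _ hh),
      h₂ W f fun h hh => hf h (Finset.mem_union_right _ hh), add_zero]
  | smul a x _ hx =>
    obtain ⟨H, h⟩ := hx
    exact ⟨H, fun W _ _ f hf => by rw [map_smul, h W f hf, smul_zero]⟩

/-- A finite diagram of pairs admits a cone. -/
theorem exists_pointedObj_cone [Abelian C] [T.Additive] [PreservesFiniteLimits T]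
    (X₀ : PointedObj T) (H : Finset (Σ X Y : PointedObj T, X ⟶ Y)) :
    ∃ (S : PointedObj T) (p : S ⟶ X₀)
      (f : ∀ X : PointedObj T, (T.obj S.obj).sing →ₗ[ℚ] (T.obj X.obj).sing),
      f X₀ = (T.map p.hom).sing ∧ ∀ h ∈ H, CompatibleWith f h := by
  classical
  -- `X₀` is inserted so that the cone has a leg to it even if no arrow of `H` touches it.
  let O : Finset (PointedObj T) := insert X₀ (H.image (fun h => h.1) ∪ H.image fun h => h.2.1)
  have m₁ : ∀ h ∈ H, h.1 ∈ O := fun h hh => Finset.mem_insert_of_mem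
    (Finset.mem_union_left _ (Finset.mem_image_of_mem (fun h => h.1) hh))
  have m₂ : ∀ h ∈ H, h.2.1 ∈ O := fun h hh => Finset.mem_insert_of_mem
    (Finset.mem_union_right _ (Finset.mem_image_of_mem (fun h => h.2.1) hh))
  obtain ⟨S, p, hp⟩ := IsCofiltered.inf_exists O
    (H.attach.image fun h : {h // h ∈ H} =>
      (⟨h.1.1, h.1.2.1, m₁ _ h.2, m₂ _ h.2, h.1.2.2⟩ :
        Σ' (X Y : PointedObj T) (_ : X ∈ O) (_ : Y ∈ O), X ⟶ Y))
  refine ⟨S, p (Finset.mem_insert_self _ _),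
    -- The value 0 outside `O` is harmless, since compatibility only concerns endpoints of arrows in
    -- `H`.
    fun X => if hX : X ∈ O then (T.map (p hX).hom).sing else 0,
    dif_pos (Finset.mem_insert_self _ _), fun h hh => ?_⟩
  rw [CompatibleWith, dif_pos (m₁ h hh), dif_pos (m₂ h hh), ← KQVect.comp_sing, ← T.map_comp,
    ← PointedObj.comp_hom, hp (m₁ h hh) (m₂ h hh)]
  exact Finset.mem_image.2 ⟨⟨h, hh⟩, Finset.mem_attach _ _, rfl⟩

/-- If finitely many formal periods `(M, σ, ω)` with the same `ω` vanish, then `ω` comes from an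
object over `M` to which all these `σ` restrict trivially. -/
theorem exists_hom_of_freeSymbol_mem [Abelian C] [T.Additive] [PreservesFiniteLimits T] {M : C}
    (s : Finset (Module.Dual ℚ (T.obj M).sing)) (ω : (T.obj M).dR)
    (hs : ∀ σ ∈ s, freeSymbol T M σ ω ∈ periodRelations T) :
    ∃ (N : C) (g : N ⟶ M) (η : (T.obj N).dR), (T.map g).dR η = ω ∧
      ∀ σ ∈ s, σ ∘ₗ (T.map g).sing = 0 := by
  classical
  choose! H hH using fun σ hσ => exists_compatible_of_mem_periodRelations (hs σ hσ)
  obtain ⟨S, p, f, hf, hc⟩ := exists_pointedObj_cone ⟨M, ω⟩ (s.biUnion H)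
  refine ⟨S.obj, p.hom, S.form, p.map_form, fun σ hσ => ?_⟩
  rw [← hf, ← pullbackChain_freeSymbol]
  exact hH σ hσ _ f fun h hh => hc h (Finset.mem_biUnion.2 ⟨σ, hσ, hh⟩)

end Compatible

theorem freeSymbol_mem_periodRelations {T : C ⥤ KQVect.{w} K} (hT : PeriodConjecture T) {M : C}
    {σ : Module.Dual ℚ (T.obj M).sing} {ω : (T.obj M).dR} (h : (T.obj M).period σ ω = 0) :
    freeSymbol T M σ ω ∈ periodRelations T := by
  rw [← Submodule.Quotient.mk_eq_zero]
  refine hT ?_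
  rw [map_zero]
  exact (freeEval_freeSymbol T M σ ω).trans h

/-! ### Subobjects, fullness and quotients. -/

section Subobjects

variable [Abelian C] {T : C ⥤ KQVect.{w} K} [T.Additive] [PreservesFiniteLimits T]

/-- A subobject `V` of `T(M)` is approximated by a morphism into `M` whose range contains `V_K` and
is contained in `V_ℚ`. -/
theorem exists_hom_range_le (hT : PeriodConjecture T) {M : C} {V : KQVect.{w} K} (i : V ⟶ T.obj M) :
    ∃ (L : C) (g : L ⟶ M), LinearMap.range i.dR ≤ LinearMap.range (T.map g).dR ∧
      LinearMap.range (T.map g).sing ≤ LinearMap.range i.sing := by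
  obtain ⟨s, hs⟩ := IsNoetherian.noetherian (LinearMap.range i.sing).dualAnnihilator
  -- The cone argument treats one form at a time, with all generators `s` of the annihilator at
  -- once; forms are then collected by induction.
  suffices H : ∀ P : Submodule K (T.obj M).dR, P.FG → P ≤ LinearMap.range i.dR →
      ∃ (L : C) (g : L ⟶ M), P ≤ LinearMap.range (T.map g).dR ∧
        LinearMap.range (T.map g).sing ≤ LinearMap.range i.sing from
    H _ (IsNoetherian.noetherian _) le_rfl
  intro P hP
  induction P, hP using Submodule.fg_induction with
  | singleton ω =>
    intro h
    obtain ⟨η, rfl⟩ := h (Submodule.mem_span_singleton_self ω)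
    obtain ⟨L, g, θ, hθ, hg⟩ := exists_hom_of_freeSymbol_mem s (i.dR η) fun σ hσ =>
      freeSymbol_mem_periodRelations hT (by
        have hσ' : σ ∈ (LinearMap.range i.sing).dualAnnihilator := hs ▸ Submodule.subset_span hσ
        have h0 : σ ∘ₗ i.sing = 0 := LinearMap.ext fun x =>
          (Submodule.mem_dualAnnihilator σ).1 hσ' _ ⟨x, rfl⟩
        rw [← KQVect.period_map, h0]
        simp [KQVect.period])
    refine ⟨L, g, (Submodule.span_singleton_le_iff_mem _ _).2 ⟨θ, hθ⟩, ?_⟩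
    rintro _ ⟨x, rfl⟩
    -- By biduality, lying in V_ℚ means being killed by every functional in its annihilator, and the
    -- generators `s` suffice.
    rw [← Subspace.dualAnnihilator_dualCoannihilator_eq (W := LinearMap.range i.sing),
      Submodule.mem_dualCoannihilator]
    intro σ hσ
    rw [← hs] at hσ
    induction hσ using Submodule.span_induction with
    | mem σ hσ => exact LinearMap.congr_fun (hg σ hσ) x
    | zero => rfl
    | add σ τ _ _ h₁ h₂ => rw [LinearMap.add_apply, h₁, h₂, add_zero]
    | smul a σ _ h => rw [LinearMap.smul_apply, h, smul_zero]
  | sup P Q _ _ hP hQ =>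
    intro h
    obtain ⟨L₁, g₁, h₁, r₁⟩ := hP (le_sup_left.trans h)
    obtain ⟨L₂, g₂, h₂, r₂⟩ := hQ (le_sup_right.trans h)
    refine ⟨L₁ ⊞ L₂, biprod.desc g₁ g₂, sup_le (h₁.trans ?_) (h₂.trans ?_), ?_⟩
    · rintro _ ⟨x, rfl⟩
      exact ⟨(T.map biprod.inl).dR x, by rw [map_comp_dR_apply, biprod.inl_desc]⟩
    · rintro _ ⟨x, rfl⟩
      exact ⟨(T.map biprod.inr).dR x, by rw [map_comp_dR_apply, biprod.inr_desc]⟩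
    · rintro _ ⟨x, rfl⟩
      rw [biprod.desc_eq, T.map_add, T.map_comp, T.map_comp]
      exact add_mem (r₁ ⟨_, rfl⟩) (r₂ ⟨_, rfl⟩)

variable [PreservesFiniteColimits T]

/-- Exactness lets `g` be replaced by its image without changing either range. Then dim V_K ≤ dim
T(im g)_K = dim T(im g)_ℚ ≤ dim V_ℚ = dim V_K. -/
theorem exists_iso_of_mono (hT : PeriodConjecture T) {M : C} {V : KQVect.{w} K} (i : V ⟶ T.obj M)
    [Mono i] : ∃ (N : C) (j : N ⟶ M) (e : T.obj N ≅ V), Mono j ∧ e.hom ≫ i = T.map j := by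
  obtain ⟨L, g, h₁, h₂⟩ := exists_hom_range_le hT i
  have hg : T.map g = T.map (factorThruImage g) ≫ T.map (image.ι g) := by
    rw [← T.map_comp, image.fac]
  have s := KQVect.surjective_of_epi (T.map (factorThruImage g))
  have t := KQVect.injective_of_mono (T.map (image.ι g))
  have hi := KQVect.injective_of_mono i
  have a₁ : LinearMap.range i.dR ≤ LinearMap.range (T.map (image.ι g)).dR := by
    rwa [hg, KQVect.comp_dR, LinearMap.range_comp_of_range_eq_top _ (LinearMap.range_eq_top.2 s.1)]
      at h₁
  have a₂ : LinearMap.range (T.map (image.ι g)).sing ≤ LinearMap.range i.sing := by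
    rwa [hg, KQVect.comp_sing, LinearMap.range_comp_of_range_eq_top _ (LinearMap.range_eq_top.2 s.2)]
      at h₂
  have d₁ := Submodule.finrank_mono a₁
  have d₂ := Submodule.finrank_mono a₂
  have e₁ := KQVect.finrank_dR_eq_finrank_sing V
  have e₂ := KQVect.finrank_dR_eq_finrank_sing (T.obj (image g))
  rw [LinearMap.finrank_range_of_inj hi.1, LinearMap.finrank_range_of_inj t.1] at d₁
  rw [LinearMap.finrank_range_of_inj hi.2, LinearMap.finrank_range_of_inj t.2] at d₂
  obtain ⟨e, he⟩ := KQVect.exists_iso_of_range_eq (T.map (image.ι g)) i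
    (Submodule.eq_of_le_of_finrank_eq a₁ (by
      rw [LinearMap.finrank_range_of_inj hi.1, LinearMap.finrank_range_of_inj t.1]; omega)).symm
    (Submodule.eq_of_le_of_finrank_eq a₂ (by
      rw [LinearMap.finrank_range_of_inj hi.2, LinearMap.finrank_range_of_inj t.2]; omega))
  exact ⟨image g, image.ι g, e, inferInstance, he⟩

/-- The graph of `f` is a subobject of T(M ⊞ N), hence comes from some L → M ⊞ N. Its projection to
M becomes an isomorphism under `T`, and faithful `T` reflects this, so L is the graph of a morphism
M → N. -/
theorem full_of_periodConjecture [T.Faithful] (hT : PeriodConjecture T) : T.Full where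
  map_surjective {M N} f := by
    let i : T.obj M ⟶ T.obj (M ⊞ N) := T.map biprod.inl + f ≫ T.map biprod.inr
    have i₁ : i ≫ T.map biprod.fst = 𝟙 _ := by
      simp [i, ← T.map_comp]
    have i₂ : i ≫ T.map biprod.snd = f := by
      simp [i, ← T.map_comp]
    have : Mono i := mono_of_mono_fac i₁
    obtain ⟨L, j, e, -, he⟩ := exists_iso_of_mono hT i
    have h₁ : T.map (j ≫ biprod.fst) = e.hom := by
      rw [T.map_comp, ← he, Category.assoc, i₁, Category.comp_id]
    have h₂ : T.map (j ≫ biprod.snd) = e.hom ≫ f := by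
      rw [T.map_comp, ← he, Category.assoc, i₂]
    have : IsIso (T.map (j ≫ biprod.fst)) := by rw [h₁]; infer_instance
    have : IsIso (j ≫ biprod.fst) := isIso_of_reflects_iso _ T
    refine ⟨inv (j ≫ biprod.fst) ≫ j ≫ biprod.snd, ?_⟩
    rw [T.map_comp, T.map_inv, h₂, IsIso.inv_comp_eq, h₁]

/-- The kernel of `q` is T(N) for some N → M, so V is T of the cokernel of N → M. -/
theorem essImage_of_epi (hT : PeriodConjecture T) {M : C} {V : KQVect.{w} K} (q : T.obj M ⟶ V)
    [Epi q] : T.essImage V := by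
  have : Mono (KQVect.kerι q) := KQVect.mono_kerι q
  obtain ⟨N, j, e, -, he⟩ := exists_iso_of_mono hT (KQVect.kerι q)
  have h0 : T.map j ≫ q = 0 := by
    rw [← he, Category.assoc, KQVect.kerι_comp, comp_zero]
  obtain ⟨d, hd⟩ := CokernelCofork.IsColimit.desc' (isColimitOfHasCokernelOfPreservesColimit T j) q h0
  replace hd : T.map (cokernel.π j) ≫ d = q := hd
  have sq := KQVect.surjective_of_epi q
  have sp := KQVect.surjective_of_epi (T.map (cokernel.π j))
  have hz : T.map j ≫ T.map (cokernel.π j) = 0 := by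
    rw [← T.map_comp, cokernel.condition, T.map_zero]
  -- This gives injectivity of `d`: an element of its kernel lifts to the kernel of `q`, which the
  -- projection to the cokernel kills.
  have hk : KQVect.kerι q ≫ T.map (cokernel.π j) = 0 := by
    rw [← cancel_epi e.hom, ← Category.assoc, he, hz, comp_zero]
  have : IsIso d := by
    refine KQVect.isIso_of_bijective d ⟨?_, ?_⟩ ⟨?_, ?_⟩
    · refine (injective_iff_map_eq_zero _).2 fun x hx => ?_
      obtain ⟨y, rfl⟩ := sp.1 x
      exact LinearMap.congr_fun (congrArg KQVect.Hom.dR hk)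
        ⟨y, (LinearMap.congr_fun (congrArg KQVect.Hom.dR hd) y).symm.trans hx⟩
    · refine Function.Surjective.of_comp (g := (T.map (cokernel.π j)).dR) ?_
      rw [← hd] at sq
      exact sq.1
    · refine (injective_iff_map_eq_zero _).2 fun x hx => ?_
      obtain ⟨y, rfl⟩ := sp.2 x
      exact LinearMap.congr_fun (congrArg KQVect.Hom.sing hk)
        ⟨y, (LinearMap.congr_fun (congrArg KQVect.Hom.sing hd) y).symm.trans hx⟩
    · refine Function.Surjective.of_comp (g := (T.map (cokernel.π j)).sing) ?_
      rw [← hd] at sq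
      exact sq.2
  exact ⟨cokernel j, ⟨asIso d⟩⟩

end Subobjects

end PeriodConjecture

theorem mainTheorem3 {K : Type k} [Field K] [Algebra K ℂ]
    {C : Type u} [Category.{v} C] [Abelian C]
    (T : C ⥤ KQVect.{w} K) [T.Additive] [T.Faithful]
    [PreservesFiniteLimits T] [PreservesFiniteColimits T]
    (hT : PeriodConjecture T) :
    (T.Full ∧ T.Faithful) ∧
      ∀ (M : C) (V : KQVect.{w} K), IsSubquotient V (T.obj M) → T.essImage V := by
  refine ⟨⟨full_of_periodConjecture hT, inferInstance⟩, ?_⟩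
  rintro M V ⟨U, i, p, _, _⟩
  -- Once U is identified with T(L), V is a quotient of an object in the image of `T`.
  obtain ⟨L, -, e, -, -⟩ := exists_iso_of_mono hT i
  exact essImage_of_epi hT (e.hom ≫ p)
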